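/- Let $\mathbb K$ be a commutative ring and $V$ a $\mathbb K$-module. Let $\mathcal{RT}(n)$ be the set of labelled rooted trees (non-planar rooted trees with vertex set $\{1,\dots,n\}$), $RT(n)=\mathbb K[\mathcal{RT}(n)]$ with the symmetric group acting by permutation of the labels, and $S(RT,V)=\bigoplus_n RT(n)\otimes_{\Sigma_n}V^{\otimes n}$. Write $\tau(x_1,\dots,x_n)$ for the class of $\tau\otimes x_1\otimes\cdots\otimes x_n$. As usual the operad $PreLie$ is identified, by the theorem of Chapoton and Livernet, with the rooted trees operad $RT$, whose composition $\tau(\upsilon_1,\dots,\upsilon_m)$ is the sum of all trees obtained by substituting the tree $\upsilon_i$ for the vertex $i$ of $\tau$ for every $i$, where for each edge of $\tau$ from $i$ to its parent $j$ the root of $\upsilon_i$ is attached to an arbitrary vertex of $\upsilon_j$. This makes $S(PreLie,-)=S(RT,-)$ a monad, with multiplication $\mu$ and unit $x\mapsto x$ (the one-vertex tree decorated by $x$). A $PreLie$-algebra $(V,\gamma)$ is an algebra over this monad, with structure map $\gamma:S(PreLie,V)\to V$. Let $F_n\in\mathcal{RT}(n+1)$ be the corolla with root $1$ and leaves $2,\dots,n+1$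 attached to the root. The bracket of $(V,\gamma)$ is $\{x,y\}=\gamma(F_1(x,y))$, and the bracket of the free algebra $S(PreLie,V)$ is the one given by $\mu$. A labelling of the vertices of a rooted tree $\tau$ with $n$ vertices by $1,\dots,n$ is increasing if the order of the labels refines the partial order of the vertices in which the root is the least element. Let $\lambda(\tau)$ be the number of increasing labellings of $\tau$, where labellings which differ by an automorphism of $\tau$ are identified (that is, the number of increasing labelled trees isomorphic to $\tau$ as non labelled trees). (1) For all $n\ge 0$ and $x,y\in V$, in $S(PreLie,V)$ $$\{\ldots\{\{x,\underbrace{y\},y\},\ldots,y}_{n}\}=\sum_{\tau}\lambda(\tau)\,\tau(x,y,\dots,y),$$ where $\tau$ runs over the isomorphism classes of rooted trees with $n+1$ vertices, and $\tau(x,y,\dots,y)$ is $\tau$ with its root decorated by $x$ and its other vertices by $y$. (2) Let $p$ be a prime number and assume that $\mathbb K$ has characteristic $p$. Let $(V,\gamma)$ be a $PreLie$-algebra and $x,y\in V$. Then $$\{\ldots\{\{x,\underbrace{y\},y\},\ldots,y}_{p}\}=\{x,\{\ldots\{\{\underbrace{y,y\},y\},\ldots,y}_{p}\}\}$$ if and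 only if $\gamma(F_p(x,\underbrace{y,\dots,y}_{p}))=0$. -/

import Mathlib

open scoped TensorProduct DirectSum BigOperators

noncomputable section

/-- A rooted tree with vertex set `α`. The parent of a vertex is the next vertex on its way to
the root; by convention the root is its own parent. -/
@[ext]
structure LabelledTree (α : Type*) where
  root : α
  parent : α → α
  parent_root : parent root = root
  reaches_root : ∀ v, ∃ k : ℕ, parent^[k] v = root

namespace LabelledTree

variable {α β γ : Type*}

/-- Transport of a rooted tree along a bijection of the vertex sets. -/
def relabel (e : α ≃ β) (T : LabelledTree α) : LabelledTree β where
  root := e T.root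
  parent := fun v => e (T.parent (e.symm v))
  parent_root := by simp [T.parent_root]
  reaches_root := fun v => by
    obtain ⟨k, hk⟩ := T.reaches_root (e.symm v)
    refine ⟨k, ?_⟩
    have h : ∀ (k : ℕ) (w : α),
        (fun v => e (T.parent (e.symm v)))^[k] (e w) = e (T.parent^[k] w) := by
      intro k
      induction k with
      | zero => intro w; rfl
      | succ k ih => intro w; simp [Function.iterate_succ_apply, ih]
    have := h k (e.symm v)
    rw [e.apply_symm_apply] at this
    rw [this, hk]

theorem relabel_refl (T : LabelledTree α) : T.relabel (Equiv.refl α) = T := by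
  ext <;> rfl

theorem relabel_trans (T : LabelledTree α) (e : α ≃ β) (e' : β ≃ γ) :
    (T.relabel e).relabel e' = T.relabel (e.trans e') := by
  ext <;> rfl

/-- Relabelling along `e` is a bijection. -/
def relabelEquiv (e : α ≃ β) : LabelledTree α ≃ LabelledTree β where
  toFun := relabel e
  invFun := relabel e.symm
  left_inv T := by rw [relabel_trans, Equiv.self_trans_symm, relabel_refl]
  right_inv T := by rw [relabel_trans, Equiv.symm_trans_self, relabel_refl]

instance [Finite α] : Finite (LabelledTree α) :=
  Finite.of_injective (fun T : LabelledTree α => (T.root, T.parent)) (by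
    intro S T h
    simp only [Prod.mk.injEq] at h
    exact LabelledTree.ext h.1 h.2)

instance [Finite α] : Fintype (LabelledTree α) := Fintype.ofFinite _

/-- The partial order on the vertices of a tree, with the root as least element: `v ≤ w` when `v`
lies on the path from `w` to the root. -/
def Below (T : LabelledTree α) (v w : α) : Prop := ∃ k : ℕ, T.parent^[k] w = v

/-- A labelled tree is increasing if the order of the labels refines the order of the tree. -/
def IsIncreasing {n : ℕ} (T : LabelledTree (Fin n)) : Prop := ∀ v w, T.Below v w → v ≤ w

/-- The corolla `F_n`: its root is the first vertex, and the `n` other vertices are leaves attached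
to the root. -/
def corolla (n : ℕ) : LabelledTree (Fin (n + 1)) where
  root := 0
  parent := fun _ => 0
  parent_root := rfl
  reaches_root := fun _ => ⟨1, rfl⟩

/-- Two labelled trees have the same underlying non labelled tree if some permutation of the
labels carries one to the other. -/
def isoSetoid (n : ℕ) : Setoid (LabelledTree (Fin n)) where
  r S T := ∃ σ : Equiv.Perm (Fin n), S.relabel σ = T
  iseqv :=
    { refl := fun T => ⟨Equiv.refl _, T.relabel_refl⟩
      symm := by
        rintro S T ⟨σ, rfl⟩
        exact ⟨σ.symm, by rw [relabel_trans, Equiv.self_trans_symm, relabel_refl]⟩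
      trans := by
        rintro S T U ⟨σ, rfl⟩ ⟨σ', rfl⟩
        exact ⟨σ.trans σ', by rw [relabel_trans]⟩ }

/-- `Θ` is one of the trees obtained by substituting the trees `υ i` for the vertices `i` of `τ`:
inside `υ i` nothing changes, the root of `Θ` is the root of the tree substituted for the root of
`τ`, and for every other vertex `i` of `τ` the root of `υ i` is attached to an arbitrary vertex of
the tree substituted for the parent of `i`. Thus `Θ` amounts to the choice, for every edge of `τ`
from `i` to its parent `j`, of a vertex of `υ j`. -/
structure IsComposite {ι : Type*} {β : ι → Type*} (τ : LabelledTree ι)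
    (υ : ∀ i, LabelledTree (β i)) (Θ : LabelledTree (Σ i, β i)) : Prop where
  root_eq : Θ.root = ⟨τ.root, (υ τ.root).root⟩
  parent_inner : ∀ i b, b ≠ (υ i).root → Θ.parent ⟨i, b⟩ = ⟨i, (υ i).parent b⟩
  parent_outer : ∀ i, i ≠ τ.root → (Θ.parent ⟨i, (υ i).root⟩).1 = τ.parent i

instance {ι : Type*} {β : ι → Type*} [Finite ι] [∀ i, Finite (β i)] (τ : LabelledTree ι)
    (υ : ∀ i, LabelledTree (β i)) : Fintype {Θ : LabelledTree (Σ i, β i) // IsComposite τ υ Θ} :=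
  Fintype.ofFinite _

theorem IsComposite.relabel_inner {ι : Type*} {β β' : ι → Type*} {τ : LabelledTree ι}
    {υ : ∀ i, LabelledTree (β i)} {Θ : LabelledTree (Σ i, β i)} (e : ∀ i, β i ≃ β' i)
    (h : IsComposite τ υ Θ) :
    IsComposite τ (fun i => (υ i).relabel (e i)) (Θ.relabel (Equiv.sigmaCongrRight e)) where
  root_eq := by simp [relabel, h.root_eq]
  parent_inner := fun i b hb => by
    have hb' : (e i).symm b ≠ (υ i).root := fun h' => hb (by simp [relabel, ← h'])
    have hp := congrArg (Equiv.sigmaCongrRight e) (h.parent_inner i _ hb')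
    exact hp
  parent_outer := fun i hi => by
    simpa [relabel, Equiv.sigmaCongrRight] using h.parent_outer i hi

theorem IsComposite.relabel_outer {ι ι' : Type*} {β : ι' → Type*} {τ : LabelledTree ι}
    {υ : ∀ i, LabelledTree (β i)} (e : ι ≃ ι') {Θ : LabelledTree (Σ i, β (e i))}
    (h : IsComposite τ (fun i => υ (e i)) Θ) :
    IsComposite (τ.relabel e) υ (Θ.relabel (Equiv.sigmaCongrLeft (β := β) e)) where
  root_eq := by
    simp [relabel, h.root_eq]
  parent_inner := fun i b hb => by
    obtain ⟨i, rfl⟩ := e.surjective i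
    have hs : (Equiv.sigmaCongrLeft (β := β) e).symm ⟨e i, b⟩ = ⟨i, b⟩ := by
      rw [Equiv.symm_apply_eq]; rfl
    simp only [relabel, hs, h.parent_inner i b hb]
    rfl
  parent_outer := fun i hi => by
    obtain ⟨i, rfl⟩ := e.surjective i
    have hs : (Equiv.sigmaCongrLeft (β := β) e).symm ⟨e i, (υ (e i)).root⟩
        = ⟨i, (υ (e i)).root⟩ := by
      rw [Equiv.symm_apply_eq]; rfl
    have hi' : i ≠ τ.root := fun h' => hi (by simp [relabel, h'])
    simp only [relabel, hs, Equiv.symm_apply_apply]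
    rw [← h.parent_outer i hi']
    rfl

theorem IsComposite.of_relabel_outer {ι ι' : Type*} {β : ι' → Type*} {τ : LabelledTree ι}
    {υ : ∀ i, LabelledTree (β i)} (e : ι ≃ ι') {Θ : LabelledTree (Σ i, β (e i))}
    (h : IsComposite (τ.relabel e) υ (Θ.relabel (Equiv.sigmaCongrLeft (β := β) e))) :
    IsComposite τ (fun i => υ (e i)) Θ := by
  have hs : ∀ i (b : β (e i)), (Equiv.sigmaCongrLeft (β := β) e).symm ⟨e i, b⟩ = ⟨i, b⟩ := by
    intro i b
    rw [Equiv.symm_apply_eq]; rfl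
  refine ⟨?_, ?_, ?_⟩
  · exact (Equiv.sigmaCongrLeft (β := β) e).injective h.root_eq
  · intro i b hb
    have h1 := h.parent_inner (e i) b hb
    simp only [relabel, hs] at h1
    exact (Equiv.sigmaCongrLeft (β := β) e).injective h1
  · intro i hi
    have h1 := h.parent_outer (e i) fun h' => hi (e.injective h')
    simp only [relabel, hs, Equiv.symm_apply_apply] at h1
    exact e.injective h1

end LabelledTree

open LabelledTree

/-- Non labelled trees with `n` vertices: isomorphism classes of rooted trees. -/
abbrev UnlabelledTree (n : ℕ) : Type := Quotient (LabelledTree.isoSetoid n)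

instance (n : ℕ) : Fintype (UnlabelledTree n) :=
  haveI : Finite (UnlabelledTree n) := Quotient.finite _
  Fintype.ofFinite _

/-- `lam t` is the number of increasing labellings of the non labelled tree `t`, that is the number
of increasing labelled trees whose underlying non labelled tree is `t`. -/
def lam {n : ℕ} (t : UnlabelledTree n) : ℕ :=
  Nat.card {T : LabelledTree (Fin n) // T.IsIncreasing ∧ (Quotient.mk (isoSetoid n) T) = t}

section MultilinearExtension

variable {K : Type*} [CommRing K] {ι X S W : Type*} [Fintype ι]
  [AddCommGroup S] [Module K S] [AddCommGroup W] [Module K W]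

/-- Multilinear maps may be defined on generators, when the relations between the generators are
respected in every variable. -/
theorem exists_multilinearMap [DecidableEq ι] (g : X → S) (hg : Submodule.span K (Set.range g) = ⊤)
    (F : (ι → X) → W)
    (hF : ∀ (a : ι → X) (i : ι), ∃ L : S →ₗ[K] W, ∀ x, L (g x) = F (Function.update a i x)) :
    ∃ f : MultilinearMap K (fun _ : ι => S) W, ∀ a, f (fun i => g (a i)) = F a := by
  classical
  let b : ∀ _ : ι, Module.Basis X K (X →₀ K) := fun _ => Finsupp.basisSingleOne
  let G : MultilinearMap K (fun _ : ι => X →₀ K) W :=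
    ((Basis.piTensorProduct b).constr K F).compMultilinearMap (PiTensorProduct.tprod K)
  have hG : ∀ a : ι → X, G (fun i => Finsupp.single (a i) 1) = F a := by
    intro a
    have h := (Basis.piTensorProduct b).constr_basis K F a
    rw [← h]
    simp [G, b, Basis.piTensorProduct_apply]
  let π : (X →₀ K) →ₗ[K] S := Finsupp.linearCombination K g
  have hπ : Function.Surjective π := by
    rw [← LinearMap.range_eq_top, Finsupp.range_linearCombination, hg]
  -- vanishing on the kernel in each variable
  have h0 : ∀ (c : ι → X →₀ K) (i : ι) (r : X →₀ K), π r = 0 →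
      G (Function.update c i r) = 0 := by
    intro c i r hr
    rcases isEmpty_or_nonempty X with hX | ⟨⟨x₀⟩⟩
    · rw [Subsingleton.elim r 0]
      exact G.map_update_zero c i
    let φ : (X →₀ K) →ₗ[K] K := Finsupp.linearCombination K (fun _ => (1 : K))
    let G' : MultilinearMap K (fun _ : ι => X →₀ K) W :=
      G.compLinearMap (Function.update (fun _ => LinearMap.id) i (φ.smulRight r))
    have hG' : ∀ c, G' c = G (Function.update c i (φ (c i) • r)) := by
      intro c
      simp only [G', MultilinearMap.compLinearMap_apply]
      congr 1
      ext1 j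
      by_cases hj : j = i
      · subst hj; simp
      · simp [hj]
    have hz : G' = 0 := by
      refine Module.Basis.ext_multilinear b fun a => ?_
      rw [hG']
      obtain ⟨L, hL⟩ := hF a i
      have hL' : L ∘ₗ π = G.toLinearMap (fun j => Finsupp.single (a j) 1) i := by
        refine Finsupp.lhom_ext' fun x => LinearMap.ext_ring ?_
        have e : Function.update (fun j => (Finsupp.single (a j) 1 : X →₀ K)) i
            (Finsupp.single x 1) = fun j => Finsupp.single (Function.update a i x j) 1 := by
          ext1 j
          by_cases hj : j = i
          · subst hj; simp
          · simp [hj]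
        simp [π, hL, e, hG]
      have hr' := LinearMap.congr_fun hL' r
      simp only [LinearMap.comp_apply, hr, map_zero, MultilinearMap.toLinearMap_apply] at hr'
      simp [b, φ, ← hr']
    have := hG' (Function.update c i (Finsupp.single x₀ 1))
    rw [hz] at this
    simpa [φ] using this.symm
  have h1 : ∀ (c : ι → X →₀ K) (i : ι) (r s : X →₀ K), π r = π s →
      G (Function.update c i r) = G (Function.update c i s) := by
    intro c i r s h
    rw [← sub_eq_zero, ← MultilinearMap.map_update_sub]
    exact h0 c i _ (by rw [map_sub, h, sub_self])
  have h2 : ∀ c c' : ι → X →₀ K, (∀ j, π (c j) = π (c' j)) → G c = G c' := by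
    intro c c' h
    have key : ∀ s : Finset ι, G (s.piecewise c' c) = G c := by
      intro s
      induction s using Finset.induction_on with
      | empty => simp
      | insert i s hi ih =>
        rw [Finset.piecewise_insert, h1 _ i (c' i) (c i) (h i).symm]
        rw [← ih]
        congr 1
        rw [Function.update_eq_self_iff]
        simp [hi]
    have := key Finset.univ
    rw [Finset.piecewise_univ] at this
    exact this.symm
  let ψ : S → (X →₀ K) := Function.surjInv hπ
  have hψ : ∀ s, π (ψ s) = s := Function.surjInv_eq hπ
  have h3 : ∀ (s : ι → S) (i : ι) (w : S) (r : X →₀ K), π r = w →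
      G (fun j => ψ (Function.update s i w j)) = G (Function.update (fun j => ψ (s j)) i r) := by
    intro s i w r hr
    refine h2 _ _ fun j => ?_
    by_cases hj : j = i
    · subst hj; simp [hψ, hr]
    · simp [hj]
  refine ⟨MultilinearMap.mk' (fun s => G fun j => ψ (s j)) ?_ ?_, ?_⟩
  · intro s i u v
    rw [h3 s i (u + v) (ψ u + ψ v) (by simp [hψ]), h3 s i u _ (hψ u), h3 s i v _ (hψ v)]
    exact G.map_update_add _ _ _ _
  · intro s i k u
    rw [h3 s i (k • u) (k • ψ u) (by simp [hψ]), h3 s i u _ (hψ u)]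
    exact G.map_update_smul _ _ _ _
  · intro a
    rw [← hG a]
    exact h2 _ _ fun j => by simp [hψ, π]

/-- Multilinear maps that agree on generators are equal. -/
theorem multilinearMap_ext_span {f f' : MultilinearMap K (fun _ : ι => S) W} (g : X → S)
    (hg : Submodule.span K (Set.range g) = ⊤)
    (h : ∀ a : ι → X, f (fun i => g (a i)) = f' (fun i => g (a i))) : f = f' := by
  let π : (X →₀ K) →ₗ[K] S := Finsupp.linearCombination K g
  have hπ : Function.Surjective π := by
    rw [← LinearMap.range_eq_top, Finsupp.range_linearCombination, hg]
  have h' : f.compLinearMap (fun _ => π) = f'.compLinearMap (fun _ => π) := by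
    refine Module.Basis.ext_multilinear (fun _ => Finsupp.basisSingleOne) fun a => ?_
    simpa [π] using h a
  ext s
  choose c hc using fun i => hπ (s i)
  have := MultilinearMap.congr_fun h' c
  simpa [hc] using this

end MultilinearExtension

section Schur

universe u v w

variable (K : Type u) [CommRing K]

/-- `RT(n)`, the free `K`-module on the set of labelled trees with `n` vertices. -/
def TreeModule (n : ℕ) : Type u := LabelledTree (Fin n) →₀ K

instance (n : ℕ) : AddCommGroup (TreeModule K n) :=
  inferInstanceAs (AddCommGroup (LabelledTree (Fin n) →₀ K))

instance (n : ℕ) : Module K (TreeModule K n) :=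
  inferInstanceAs (Module K (LabelledTree (Fin n) →₀ K))

/-- A labelled tree as a basis element of `RT(n)`. -/
def TreeModule.of {n : ℕ} (T : LabelledTree (Fin n)) : TreeModule K n :=
  Finsupp.single T (1 : K)

variable {K} in
/-- The linear extension of a map defined on labelled trees. -/
def TreeModule.lift {n : ℕ} {W : Type w} [AddCommGroup W] [Module K W]
    (φ : LabelledTree (Fin n) → W) : TreeModule K n →ₗ[K] W :=
  (Finsupp.lift W K (LabelledTree (Fin n)) φ : (LabelledTree (Fin n) →₀ K) →ₗ[K] W)

variable {K} in
@[simp]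
theorem TreeModule.lift_of {n : ℕ} {W : Type w} [AddCommGroup W] [Module K W]
    (φ : LabelledTree (Fin n) → W) (T : LabelledTree (Fin n)) :
    TreeModule.lift φ (TreeModule.of K T) = φ T :=
  (Finsupp.sum_single_index (zero_smul K (φ T))).trans (one_smul K (φ T))

variable {K} in
theorem TreeModule.hom_ext {n : ℕ} {W : Type w} [AddCommGroup W] [Module K W]
    {f g : TreeModule K n →ₗ[K] W} (h : ∀ T, f (TreeModule.of K T) = g (TreeModule.of K T)) :
    f = g :=
  Finsupp.lhom_ext' (M := K) (R := K) (σ₁₂ := RingHom.id K) fun T => LinearMap.ext_ring (h T)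

/-- The action of the symmetric group on `RT(n)` by permutation of the labels. -/
def treeRep (n : ℕ) : Representation K (Equiv.Perm (Fin n)) (TreeModule K n) where
  toFun σ := TreeModule.lift fun T => TreeModule.of K (T.relabel σ)
  map_one' := TreeModule.hom_ext fun T => by
    rw [TreeModule.lift_of]
    exact congrArg _ T.relabel_refl
  map_mul' σ σ' := TreeModule.hom_ext fun T => by
    rw [Module.End.mul_apply, TreeModule.lift_of, TreeModule.lift_of, TreeModule.lift_of,
      relabel_trans]
    rfl

@[simp]
theorem treeRep_of {n : ℕ} (σ : Equiv.Perm (Fin n)) (T : LabelledTree (Fin n)) :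
    treeRep K n σ (TreeModule.of K T) = TreeModule.of K (T.relabel σ) :=
  TreeModule.lift_of _ T

variable (V : Type v) [AddCommGroup V] [Module K V]

/-- The action of the symmetric group on the tensor power `V^{⊗n}` by permutation of the factors. -/
def tensorRep (n : ℕ) : Representation K (Equiv.Perm (Fin n)) (⨂[K] _ : Fin n, V) where
  toFun σ := (PiTensorProduct.reindex K (fun _ => V) σ).toLinearMap
  map_one' := by
    ext x
    simp only [LinearMap.compMultilinearMap_apply, LinearEquiv.coe_coe,
      PiTensorProduct.reindex_tprod]
    rfl
  map_mul' σ σ' := by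
    ext x
    simp only [LinearMap.compMultilinearMap_apply, LinearEquiv.coe_coe, Module.End.mul_apply,
      PiTensorProduct.reindex_tprod]
    rfl

@[simp]
theorem tensorRep_tprod {n : ℕ} (σ : Equiv.Perm (Fin n)) (x : Fin n → V) :
    tensorRep K V n σ (PiTensorProduct.tprod K x) = PiTensorProduct.tprod K (x ∘ σ.symm) :=
  PiTensorProduct.reindex_tprod σ x

/-- The diagonal action on `RT(n) ⊗ V^{⊗n}`. -/
abbrev diagRep (n : ℕ) : Representation K (Equiv.Perm (Fin n))
    (TreeModule K n ⊗[K] (⨂[K] _ : Fin n, V)) :=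
  (treeRep K n).tprod (tensorRep K V n)

/-- The Schur functor `S(RT, V)`: the direct sum over `n` of the coinvariants of the symmetric
group on `n` letters in `RT(n) ⊗ V^{⊗n}`. -/
abbrev SRT : Type (max u v) := ⨁ n : ℕ, (diagRep K V n).Coinvariants

variable {V}

/-- The element `τ(x_1, …, x_n)` of `S(RT, V)`, as a multilinear map in the `x_i`. -/
def treeM {n : ℕ} (T : LabelledTree (Fin n)) : MultilinearMap K (fun _ : Fin n => V) (SRT K V) :=
  ((DirectSum.lof K ℕ (fun n => (diagRep K V n).Coinvariants) n) ∘ₗ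
    (Representation.Coinvariants.mk (diagRep K V n)) ∘ₗ
    (TensorProduct.mk K _ _ (TreeModule.of K T))).compMultilinearMap (PiTensorProduct.tprod K)

theorem treeM_relabel {n : ℕ} (T : LabelledTree (Fin n)) (σ : Equiv.Perm (Fin n)) (x : Fin n → V) :
    treeM K (T.relabel σ) (x ∘ σ.symm) = treeM K T x := by
  simp only [treeM, LinearMap.compMultilinearMap_apply, LinearMap.comp_apply]
  congr 1
  have h := Representation.Coinvariants.mk_self_apply (diagRep K V n) σ
    (TreeModule.of K T ⊗ₜ[K] PiTensorProduct.tprod K x)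
  simpa using h

variable {K} in
/-- The universal property of `S(RT, V)`. -/
def SRT.lift {W : Type w} [AddCommGroup W] [Module K W]
    (φ : ∀ n, LabelledTree (Fin n) → MultilinearMap K (fun _ : Fin n => V) W)
    (h : ∀ n (σ : Equiv.Perm (Fin n)) T x, φ n (T.relabel σ) (x ∘ σ.symm) = φ n T x) :
    SRT K V →ₗ[K] W :=
  DirectSum.toModule K ℕ W fun n =>
    Representation.Coinvariants.lift _
      (TensorProduct.lift (TreeModule.lift fun T => PiTensorProduct.lift (φ n T))) (by
        intro σ
        refine TensorProduct.ext (TreeModule.hom_ext fun T => PiTensorProduct.ext ?_)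
        ext x
        simpa using h n σ T x)

variable {K} in
theorem SRT.lift_treeM {W : Type w} [AddCommGroup W] [Module K W]
    (φ : ∀ n, LabelledTree (Fin n) → MultilinearMap K (fun _ : Fin n => V) W)
    (h : ∀ n (σ : Equiv.Perm (Fin n)) T x, φ n (T.relabel σ) (x ∘ σ.symm) = φ n T x)
    {n : ℕ} (T : LabelledTree (Fin n)) (x : Fin n → V) :
    SRT.lift φ h (treeM K T x) = φ n T x := by
  simp [SRT.lift, treeM]

variable {K} in
theorem SRT.hom_ext {W : Type w} [AddCommGroup W] [Module K W] {f g : SRT K V →ₗ[K] W}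
    (h : ∀ n (T : LabelledTree (Fin n)) (x : Fin n → V), f (treeM K T x) = g (treeM K T x)) :
    f = g := by
  refine DirectSum.linearMap_ext _ fun n => ?_
  refine Representation.Coinvariants.hom_ext ?_
  refine TensorProduct.ext (TreeModule.hom_ext fun T => PiTensorProduct.ext ?_)
  ext x
  exact h n T x

variable (V) in
theorem SRT.span_treeM :
    Submodule.span K (Set.range fun a : (Σ n, LabelledTree (Fin n) × (Fin n → V)) =>
      treeM K a.2.1 a.2.2) = ⊤ := by
  set P := Submodule.span K (Set.range fun a : (Σ n, LabelledTree (Fin n) × (Fin n → V)) =>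
      treeM K a.2.1 a.2.2)
  have h : P.mkQ = 0 := by
    refine SRT.hom_ext fun n T x => ?_
    simp only [LinearMap.zero_apply, Submodule.mkQ_apply, Submodule.Quotient.mk_eq_zero]
    exact Submodule.subset_span ⟨⟨n, T, x⟩, rfl⟩
  rw [← Submodule.ker_mkQ P, h, LinearMap.ker_zero]

/-- The element of `S(RT, V)` given by a tree with an arbitrary finite vertex set `α`, whose
vertices are decorated by elements of `V`; it does not depend on the numbering of the vertices. -/
def treeOn {α : Type*} [Fintype α] (T : LabelledTree α) :
    MultilinearMap K (fun _ : α => V) (SRT K V) :=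
  (treeM K (T.relabel (Fintype.equivFin α))).domDomCongr (Fintype.equivFin α).symm

theorem treeOn_eq {α : Type*} [Fintype α] {n : ℕ} (e : α ≃ Fin n) (T : LabelledTree α) (x : α → V) :
    treeOn K T x = treeM K (T.relabel e) (x ∘ e.symm) := by
  obtain rfl : Fintype.card α = n := by simpa using Fintype.card_congr e
  rw [← treeM_relabel K (T.relabel e) (e.symm.trans (Fintype.equivFin α)), relabel_trans]
  have he : e.trans (e.symm.trans (Fintype.equivFin α)) = Fintype.equivFin α := by
    ext i; simp
  rw [he]
  simp only [treeOn, MultilinearMap.domDomCongr_apply]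
  congr 1
  ext i
  simp

theorem treeOn_relabel {α β : Type*} [Fintype α] [Fintype β] (e : α ≃ β) (T : LabelledTree α)
    (x : α → V) : treeOn K (T.relabel e) (x ∘ e.symm) = treeOn K T x := by
  rw [treeOn_eq K (Fintype.equivFin β), treeOn_eq K (e.trans (Fintype.equivFin β)), relabel_trans]
  rfl

section Substitution

variable {ι : Type*}

/-- The element `τ(υ_1(x^1), …, υ_m(x^m))` composed in `S(RT, V)`: the sum of all the trees obtained
by substituting the trees `υ i` for the vertices of `τ`, decorated by the families `x i`. -/
def compositeSum {β : ι → Type*} [Fintype ι] [∀ i, Fintype (β i)] (τ : LabelledTree ι)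
    (υ : ∀ i, LabelledTree (β i)) (x : ∀ i, β i → V) : SRT K V :=
  ∑ Θ : {Θ : LabelledTree (Σ i, β i) // IsComposite τ υ Θ}, treeOn K Θ.1 fun p => x p.1 p.2

theorem compositeSum_relabel_inner {β β' : ι → Type*} [Fintype ι] [∀ i, Fintype (β i)]
    [∀ i, Fintype (β' i)] (e : ∀ i, β i ≃ β' i) (τ : LabelledTree ι)
    (υ : ∀ i, LabelledTree (β i)) (x : ∀ i, β i → V) :
    compositeSum K τ (fun i => (υ i).relabel (e i)) (fun i => x i ∘ (e i).symm) =
      compositeSum K τ υ x := by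
  symm
  refine Fintype.sum_equiv
    ((relabelEquiv (Equiv.sigmaCongrRight e)).subtypeEquiv fun Θ => ⟨fun h => ?_, fun h => ?_⟩)
    _ _ fun Θ => ?_
  · exact h.relabel_inner e
  · have h' := IsComposite.relabel_inner (fun i => (e i).symm) h
    have e1 : (fun i => ((υ i).relabel (e i)).relabel (e i).symm) = υ := by
      funext i
      rw [relabel_trans, Equiv.self_trans_symm, relabel_refl]
    have e2 : ((relabelEquiv (Equiv.sigmaCongrRight e)) Θ).relabel
        (Equiv.sigmaCongrRight fun i => (e i).symm) = Θ :=
      (relabelEquiv (Equiv.sigmaCongrRight e)).symm_apply_apply Θ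
    rwa [e1, e2] at h'
  · exact (treeOn_relabel K (Equiv.sigmaCongrRight e) Θ.1 fun p => x p.1 p.2).symm

theorem compositeSum_relabel_outer {ι' : Type*} {β : ι' → Type*} [Fintype ι] [Fintype ι']
    [∀ i, Fintype (β i)] (e : ι ≃ ι') (τ : LabelledTree ι)
    (υ : ∀ i, LabelledTree (β i)) (x : ∀ i, β i → V) :
    compositeSum K (τ.relabel e) υ x =
      compositeSum K τ (fun i => υ (e i)) (fun i => x (e i)) := by
  symm
  refine Fintype.sum_equiv
    ((relabelEquiv (Equiv.sigmaCongrLeft (β := β) e)).subtypeEquiv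
      fun Θ => ⟨fun h => ?_, fun h => ?_⟩) _ _ fun Θ => ?_
  · exact h.relabel_outer e
  · exact IsComposite.of_relabel_outer e h
  · rw [← treeOn_relabel K (Equiv.sigmaCongrLeft (β := β) e) Θ.1]
    refine congrArg (treeOn K _) ?_
    funext p
    obtain ⟨⟨i, b⟩, rfl⟩ := (Equiv.sigmaCongrLeft (β := β) e).surjective p
    exact (congrArg (fun q : Σ i, β (e i) => x (e q.1) q.2)
      (Equiv.symm_apply_apply (Equiv.sigmaCongrLeft (β := β) e) ⟨i, b⟩))

/-- Additivity and homogeneity of the composite in the decorations of one tree. -/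
theorem compositeSum_update {β : ι → Type*} [Fintype ι] [DecidableEq ι] [∀ i, Fintype (β i)]
    (τ : LabelledTree ι) (υ : ∀ i, LabelledTree (β i)) (x : ∀ i, β i → V) (i : ι) :
    ∃ M : MultilinearMap K (fun _ : β i => V) (SRT K V),
      ∀ y, M y = compositeSum K τ υ (Function.update x i y) := by
  classical
  have hu : ∀ (y : β i → V) (k : β i) (v : V),
      (fun p : Σ i, β i => Function.update x i (Function.update y k v) p.1 p.2) =
        Function.update (fun p : Σ i, β i => Function.update x i y p.1 p.2) ⟨i, k⟩ v := by
    intro y k v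
    funext ⟨j, b⟩
    by_cases hj : j = i
    · subst hj
      by_cases hb : b = k
      · subst hb; simp
      · have : (⟨j, b⟩ : Σ i, β i) ≠ ⟨j, k⟩ := fun h => hb (by simpa using h)
        simp [hb, this]
    · have : (⟨j, b⟩ : Σ i, β i) ≠ ⟨i, k⟩ := fun h => hj (congrArg Sigma.fst h)
      simp [hj, this]
  refine ⟨MultilinearMap.mk' (fun y => compositeSum K τ υ (Function.update x i y)) ?_ ?_,
    fun y => rfl⟩
  · intro y k u v
    simp only [compositeSum, hu, MultilinearMap.map_update_add, Finset.sum_add_distrib]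
  · intro y k c u
    simp only [compositeSum, hu, MultilinearMap.map_update_smul, Finset.smul_sum]

end Substitution

variable (V) in
/-- A labelled tree together with a decoration of its vertices by elements of `V`. -/
abbrev DecoratedTree : Type v := Σ n : ℕ, LabelledTree (Fin n) × (Fin n → V)

/-- Two decorated trees are isomorphic if a bijection of the vertices carries one to the other. -/
def DecoratedTree.Iso (a a' : DecoratedTree V) : Prop :=
  ∃ e : Fin a.1 ≃ Fin a'.1, a'.2.1 = a.2.1.relabel e ∧ a'.2.2 = a.2.2 ∘ e.symm

theorem DecoratedTree.Iso.refl (a : DecoratedTree V) : DecoratedTree.Iso a a :=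
  ⟨Equiv.refl _, (relabel_refl _).symm, rfl⟩

/-- `compositeSum` for a family of decorated trees. -/
def compositeSumDec {m : ℕ} (τ : LabelledTree (Fin m)) (a : Fin m → DecoratedTree V) : SRT K V :=
  compositeSum K τ (fun i => (a i).2.1) (fun i => (a i).2.2)

theorem compositeSumDec_congr {m : ℕ} (τ : LabelledTree (Fin m)) (a a' : Fin m → DecoratedTree V)
    (h : ∀ j, DecoratedTree.Iso (a j) (a' j)) :
    compositeSumDec K τ a' = compositeSumDec K τ a := by
  choose e h1 h2 using h
  simp only [compositeSumDec, h1, h2]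
  exact compositeSum_relabel_inner K e τ _ _

theorem exists_compositeSumDec_update {m : ℕ} (τ : LabelledTree (Fin m)) (i : Fin m)
    (g : DecoratedTree V) (b : Fin m → DecoratedTree V) (hb : b i = g) :
    ∃ M : MultilinearMap K (fun _ : Fin g.1 => V) (SRT K V),
      ∀ y, M y = compositeSumDec K τ (Function.update b i ⟨g.1, g.2.1, y⟩) := by
  subst hb
  obtain ⟨M, hM⟩ := compositeSum_update K τ (fun j => (b j).2.1) (fun j => (b j).2.2) i
  refine ⟨M, fun y => ?_⟩
  rw [hM]
  have : Function.update b i ⟨(b i).1, (b i).2.1, y⟩ = fun j =>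
      ⟨(b j).1, (b j).2.1, Function.update (fun j => (b j).2.2) i y j⟩ := by
    funext j
    by_cases hj : j = i
    · subst hj; simp
    · simp [hj]
  rw [this]
  rfl

variable (V) in
theorem exists_substitution {m : ℕ} (τ : LabelledTree (Fin m)) :
    ∃ f : MultilinearMap K (fun _ : Fin m => SRT K V) (SRT K V),
      ∀ a : Fin m → DecoratedTree V,
        f (fun i => treeM K (a i).2.1 (a i).2.2) = compositeSumDec K τ a := by
  refine exists_multilinearMap _ (SRT.span_treeM K V) _ fun a i => ?_
  have hM : ∀ n (T : LabelledTree (Fin n)), ∃ M : MultilinearMap K (fun _ : Fin n => V) (SRT K V),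
      ∀ y, M y = compositeSumDec K τ (Function.update a i ⟨n, T, y⟩) := by
    intro n T
    obtain ⟨M, hM⟩ := exists_compositeSumDec_update K τ i ⟨n, T, 0⟩
      (Function.update a i ⟨n, T, 0⟩) (by simp)
    exact ⟨M, fun y => by rw [hM]; simp⟩
  choose M hM using hM
  refine ⟨SRT.lift M fun n σ T x => ?_, fun x => ?_⟩
  · rw [hM, hM]
    refine compositeSumDec_congr K τ _ _ fun j => ?_
    by_cases hj : j = i
    · subst hj
      rw [Function.update_self, Function.update_self]
      exact ⟨σ, rfl, rfl⟩
    · rw [Function.update_of_ne hj, Function.update_of_ne hj]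
      exact DecoratedTree.Iso.refl _
  · rw [SRT.lift_treeM, hM]

/-- The substitution of elements of `S(RT, V)` for the vertices of a labelled tree, as a
multilinear map; it is characterized by `SRT.subst_treeM`. -/
def SRT.subst {m : ℕ} (τ : LabelledTree (Fin m)) :
    MultilinearMap K (fun _ : Fin m => SRT K V) (SRT K V) :=
  (exists_substitution K V τ).choose

theorem SRT.subst_treeM {m : ℕ} (τ : LabelledTree (Fin m)) {n : Fin m → ℕ}
    (υ : ∀ i, LabelledTree (Fin (n i))) (x : ∀ i, Fin (n i) → V) :
    SRT.subst K τ (fun i => treeM K (υ i) (x i)) = compositeSum K τ υ x :=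
  (exists_substitution K V τ).choose_spec fun i => ⟨n i, υ i, x i⟩

variable (V) in
/-- The multiplication `μ : S(RT, S(RT, V)) → S(RT, V)` of the monad `S(RT, -)`. -/
def SRT.mu : SRT K (SRT K V) →ₗ[K] SRT K V :=
  SRT.lift (fun _ τ => SRT.subst K τ) (by
    intro m σ τ s
    have h : (SRT.subst K (τ.relabel σ)).domDomCongr σ.symm = SRT.subst (V := V) K τ := by
      refine multilinearMap_ext_span _ (SRT.span_treeM K V) fun a => ?_
      rw [MultilinearMap.domDomCongr_apply]
      have h1 := SRT.subst_treeM K (τ.relabel σ) (fun i => (a (σ.symm i)).2.1)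
        (fun i => (a (σ.symm i)).2.2)
      have h2 := SRT.subst_treeM K τ (fun i => (a i).2.1) (fun i => (a i).2.2)
      rw [h1, h2, compositeSum_relabel_outer]
      refine compositeSumDec_congr K τ a (fun i => a (σ.symm (σ i))) fun j => ?_
      rw [Equiv.symm_apply_apply]
      exact DecoratedTree.Iso.refl _
    exact MultilinearMap.congr_fun h s)

theorem SRT.mu_treeM {m : ℕ} (τ : LabelledTree (Fin m)) {n : Fin m → ℕ}
    (υ : ∀ i, LabelledTree (Fin (n i))) (x : ∀ i, Fin (n i) → V) :
    SRT.mu K V (treeM K τ fun i => treeM K (υ i) (x i)) = compositeSum K τ υ x := by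
  exact (SRT.lift_treeM _ _ _ _).trans (SRT.subst_treeM K τ υ x)

theorem update_fin_one (z : V) :
    Function.update (fun _ : Fin (0 + 1) => (0 : V)) 0 z = fun _ => z := by
  funext i
  obtain rfl : i = 0 := Subsingleton.elim (α := Fin 1) i 0
  rw [Function.update_self]

/-- The unit `V → S(RT, V)` of the monad `S(RT, -)`: it sends `x` to the tree with one vertex,
decorated by `x`. -/
def SRT.unit : V →ₗ[K] SRT K V where
  toFun x := treeM K (corolla 0) fun _ => x
  map_add' x y := by
    have h := (treeM K (V := V) (corolla 0)).map_update_add (fun _ => 0) 0 x y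
    simpa only [update_fin_one] using h
  map_smul' c x := by
    have h := (treeM K (V := V) (corolla 0)).map_update_smul (fun _ => 0) 0 c x
    simpa only [update_fin_one, RingHom.id_apply] using h

variable {K} in
/-- The functor `S(RT, -)` on linear maps. -/
def SRT.map {W : Type w} [AddCommGroup W] [Module K W] (f : V →ₗ[K] W) : SRT K V →ₗ[K] SRT K W :=
  SRT.lift (fun _ T => (treeM K T).compLinearMap fun _ => f) fun _ σ T x =>
    treeM_relabel K T σ fun i => f (x i)

variable {K} in
theorem SRT.map_treeM {W : Type w} [AddCommGroup W] [Module K W] (f : V →ₗ[K] W) {n : ℕ}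
    (T : LabelledTree (Fin n)) (x : Fin n → V) :
    SRT.map f (treeM K T x) = treeM K T fun i => f (x i) :=
  SRT.lift_treeM _ _ _ _

variable (V) in
/-- A `PreLie`-algebra structure on `V`: an algebra over the monad `S(PreLie, -)`, where the operad
`PreLie` is realized by rooted trees. -/
structure PreLieAlgebra where
  γ : SRT K V →ₗ[K] V
  γ_unit : γ ∘ₗ SRT.unit K = LinearMap.id
  γ_mu : γ ∘ₗ SRT.mu K V = γ ∘ₗ SRT.map γ

variable {K}

/-- The `PreLie` bracket `{x, y} = γ(F_1(x, y))` induced by a structure map `γ : S(RT, V) → V`,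
where `F_1` is the tree with root `1` and a leaf `2`. For `γ = μ` this is the bracket of the free
algebra `S(RT, V)`. -/
def preLieBracket (γ : SRT K V →ₗ[K] V) (x y : V) : V := γ (treeM K (corolla 1) ![x, y])

/-- The iterated bracket `{…{{x, y}, y}…, y}` with `n` copies of `y`. -/
def iterBracket (γ : SRT K V →ₗ[K] V) (x y : V) : ℕ → V
  | 0 => x
  | n + 1 => preLieBracket γ (iterBracket γ x y n) y

variable (K) in
/-- The element `t(x, y, …, y)` of `S(RT, V)`: the root of the non labelled tree `t` is decorated
by `x` and its other vertices by `y`. -/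
def UnlabelledTree.eval {n : ℕ} (t : UnlabelledTree n) (x y : V) : SRT K V :=
  Quotient.lift (fun T : LabelledTree (Fin n) => treeM K T fun v => if v = T.root then x else y) (by
    rintro T _ ⟨σ, rfl⟩
    refine (treeM_relabel K T σ _).symm.trans (congrArg (treeM K (T.relabel σ)) ?_)
    funext v
    by_cases h : v = σ T.root <;> simp [relabel, Equiv.symm_apply_eq, h]) t

end Schur

end

/-! Part (1). In the free algebra, bracketing a tree with a generator `y` sums over all ways of
attaching a leaf `y` to a vertex (`preLieBracket_mu_treeOn`). A tree with `n + 2` vertices that is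
increasing arises exactly once by attaching the last label as a leaf to an increasing tree with `n +
1` vertices (`increasingGraftEquiv`). Hence the iterated bracket is the sum over all increasing
trees, and collecting isomorphic ones produces the coefficients `lam`.

Part (2). Put `w_k = {…{y, y}…, y}` with `k` brackets, so `w_0 = y`. Bracketing a corolla `F_m(x,
b_1, …, b_m)` with `y` either adds a leaf `y` at the root or replaces some `b_j` by `{b_j, y}`
(`preLieBracket_γ_star`). Since leaves of a corolla may be permuted, the values of `F_m(x, w_{k_1},
…, w_{k_m})` are recorded by monomials `X_{k_1} ⋯ X_{k_m}`, and `{-, y}` becomes the operator `D +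
X_0`, where `D` is the derivation with `D X_k = X_{k+1}` (`corollaMap_shift_add_mul`). So `{…{x,
y}…, y}` is the image of `(D + X_0)^n (1)`, a complete Bell polynomial. In characteristic `p` and
for `n = p` all its parts vanish except `X_0^p` and `X_{p-1}` (`sum_partialBell_prime`). These two
correspond to `F_p(x, y, …, y)` and `{x, w_{p-1}}`, and `w_{p-1}` contains `p` copies of `y`; the
equivalence follows by cancellation. -/

noncomputable section

open LabelledTree

/-! ### Attaching a leaf to a tree; corollas on arbitrary vertex sets. -/

namespace LabelledTree

variable {α β : Type*}

/-- The tree obtained from `T` by attaching a new leaf to the vertex `v`. -/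
def graft (T : LabelledTree α) (v : α) : LabelledTree (Option α) where
  root := some T.root
  parent := fun w => w.elim (some v) fun b => some (T.parent b)
  parent_root := by simp [T.parent_root]
  reaches_root := by
    have h : ∀ (k : ℕ) (b : α),
        (fun w : Option α => w.elim (some v) fun b => some (T.parent b))^[k] (some b) =
          some (T.parent^[k] b) := by
      intro k
      induction k with
      | zero => intro b; rfl
      | succ k ih => intro b; simp [Function.iterate_succ_apply, ih]
    rintro (_ | b)
    · obtain ⟨k, hk⟩ := T.reaches_root v
      exact ⟨k + 1, by rw [Function.iterate_succ_apply, Option.elim_none, h, hk]⟩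
    · obtain ⟨k, hk⟩ := T.reaches_root b
      exact ⟨k, by rw [h, hk]⟩

@[simp]
theorem graft_root (T : LabelledTree α) (v : α) : (T.graft v).root = some T.root := rfl

@[simp]
theorem graft_parent_none (T : LabelledTree α) (v : α) : (T.graft v).parent none = some v := rfl

@[simp]
theorem graft_parent_some (T : LabelledTree α) (v b : α) :
    (T.graft v).parent (some b) = some (T.parent b) := rfl

/-- The tree with root `r` whose other vertices are leaves attached to the root. -/
def star (r : α) : LabelledTree α where
  root := r
  parent := fun _ => r
  parent_root := rfl
  reaches_root := fun _ => ⟨1, rfl⟩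

theorem corolla_eq_star (n : ℕ) : corolla n = star 0 := rfl

theorem star_relabel (e : α ≃ β) (r : α) : (star r).relabel e = star (e r) := rfl

theorem star_graft (r : α) : (star r).graft r = star (some r) := by
  ext w
  · rfl
  · rcases w with _ | b <;> rfl

end LabelledTree

/-! ### Substitution for trees on arbitrary vertex sets, and the bracket with a generator. -/

section Composition

universe u v

variable (K : Type u) [CommRing K] {V : Type v} [AddCommGroup V] [Module K V]

theorem treeOn_fin {n : ℕ} (T : LabelledTree (Fin n)) (x : Fin n → V) :
    treeOn K T x = treeM K T x := by
  rw [treeOn_eq K (Equiv.refl _), relabel_refl]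
  rfl

theorem SRT.map_treeOn {W : Type*} [AddCommGroup W] [Module K W] (f : V →ₗ[K] W) {α : Type*}
    [Fintype α] (T : LabelledTree α) (x : α → V) :
    SRT.map f (treeOn K T x) = treeOn K T fun i => f (x i) := by
  rw [treeOn_eq K (Fintype.equivFin α), SRT.map_treeM, treeOn_eq K (Fintype.equivFin α)]
  rfl

theorem SRT.mu_treeM_treeOn {m : ℕ} {β : Fin m → Type*} [∀ i, Fintype (β i)]
    (τ : LabelledTree (Fin m)) (υ : ∀ i, LabelledTree (β i)) (x : ∀ i, β i → V) :
    SRT.mu K V (treeM K τ fun i => treeOn K (υ i) (x i)) = compositeSum K τ υ x := by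
  rw [← compositeSum_relabel_inner K (fun i => Fintype.equivFin (β i))]
  exact SRT.mu_treeM K τ _ _

/-- Frees all later computations of `μ` from numberings: vertex sets such as `Option α` or a fibre
of a map can be used directly. -/
theorem SRT.mu_treeOn {ι : Type*} [Fintype ι] {β : ι → Type*} [∀ i, Fintype (β i)]
    (τ : LabelledTree ι) (υ : ∀ i, LabelledTree (β i)) (x : ∀ i, β i → V) :
    SRT.mu K V (treeOn K τ fun i => treeOn K (υ i) (x i)) = compositeSum K τ υ x := by
  let e := (Fintype.equivFin ι).symm
  have h := compositeSum_relabel_outer K e (τ.relabel e.symm) υ x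
  rw [relabel_trans, Equiv.symm_trans_self, relabel_refl] at h
  rw [treeOn_eq K e.symm, h]
  exact SRT.mu_treeM_treeOn K _ _ _

theorem SRT.treeOn_eq_unit {α : Type*} [Fintype α] [Unique α] (T : LabelledTree α) (x : α → V) :
    treeOn K T x = SRT.unit K (x default) := by
  let e : α ≃ Fin 1 := Equiv.ofUnique α (Fin 1)
  rw [treeOn_eq K e]
  have h1 : T.relabel e = corolla 0 := by
    ext w
    · exact congrArg _ (Subsingleton.elim (α := Fin 1) _ _)
    · exact congrArg _ (Subsingleton.elim (α := Fin 1) _ _)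
  have h2 : x ∘ e.symm = fun _ => x default := by
    funext i
    exact congrArg x (Subsingleton.elim _ _)
  rw [h1, h2]
  rfl

/-- The disjoint union of a type and of a type with one element. -/
def sigmaFinTwoEquivOption (β : Fin 2 → Type*) [Unique (β 1)] : (Σ i, β i) ≃ Option (β 0) where
  toFun p := match p with
    | ⟨0, b⟩ => some b
    | ⟨1, _⟩ => none
  invFun w := w.elim ⟨1, default⟩ fun b => ⟨0, b⟩
  left_inv := by
    rintro ⟨i, b⟩
    fin_cases i
    · rfl
    · exact congrArg (Sigma.mk 1) (Subsingleton.elim (α := β 1) _ _)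
  right_inv := by rintro (_ | b) <;> rfl

/-- The corolla has a single edge, so a composite amounts to the choice of the vertex of `υ 0` to
which the only vertex of `υ 1` is attached. -/
theorem isComposite_corolla_one_iff {β : Fin 2 → Type*} [Unique (β 1)]
    (υ : ∀ i, LabelledTree (β i)) (Θ : LabelledTree (Σ i, β i)) :
    IsComposite (corolla 1) υ Θ ↔
      ∃ v, (υ 0).graft v = Θ.relabel (sigmaFinTwoEquivOption β) := by
  set e := sigmaFinTwoEquivOption β
  have e0 : ∀ b : β 0, e ⟨0, b⟩ = some b := fun b => rfl
  have s0 : ∀ b : β 0, e.symm (some b) = ⟨0, b⟩ := fun b => rfl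
  have s1 : e.symm none = ⟨1, default⟩ := rfl
  constructor
  · intro h
    have h1 := h.parent_outer 1 (by simp [corolla])
    have hr : (υ 1).root = default := Subsingleton.elim _ _
    rw [hr] at h1
    obtain ⟨v, hv⟩ : ∃ v : β 0, Θ.parent ⟨1, default⟩ = ⟨0, v⟩ := by
      revert h1
      generalize Θ.parent ⟨1, default⟩ = q
      obtain ⟨i, b⟩ := q
      rintro (rfl : i = 0)
      exact ⟨b, rfl⟩
    refine ⟨v, LabelledTree.ext ?_ ?_⟩
    · simp only [graft_root, relabel, h.root_eq]
      rfl
    · funext w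
      rcases w with _ | b
      · simp only [graft_parent_none, relabel, s1, hv]
        rfl
      · simp only [graft_parent_some, relabel, s0]
        -- `parent_inner` says nothing about roots; here the root of `υ 0` is the root of `Θ`, which
        -- is its own parent.
        by_cases hb : b = (υ 0).root
        · have hroot : (⟨0, b⟩ : Σ i, β i) = Θ.root := by rw [h.root_eq, hb]; rfl
          rw [hroot, Θ.parent_root, ← hroot, hb, (υ 0).parent_root, e0]
        · rw [h.parent_inner 0 b hb, e0]
  · rintro ⟨v, hv⟩
    have hr := congrArg LabelledTree.root hv
    have hp : ∀ q, Θ.parent q = e.symm (((υ 0).graft v).parent (e q)) := by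
      intro q
      rw [hv]
      simp [relabel]
    refine ⟨?_, ?_, ?_⟩
    · exact e.injective hr.symm
    · intro i b hb
      fin_cases i
      · exact hp ⟨0, b⟩
      · exact absurd (Subsingleton.elim (α := β 1) _ _) hb
    · intro i hi
      fin_cases i
      · exact absurd rfl hi
      · have := hp ⟨1, (υ 1).root⟩
        exact congrArg Sigma.fst this

theorem compositeSum_corolla_one {β : Fin 2 → Type*} [Unique (β 1)] [∀ i, Fintype (β i)]
    (υ : ∀ i, LabelledTree (β i)) (x : ∀ i, β i → V) :
    compositeSum K (corolla 1) υ x =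
      ∑ v, treeOn K ((υ 0).graft v) fun w => w.elim (x 1 default) (x 0) := by
  let e := sigmaFinTwoEquivOption β
  have hinj : Function.Injective fun v : β 0 => (υ 0).graft v := by
    intro v w h
    have := congrFun (congrArg LabelledTree.parent h) none
    simpa using this
  let E : β 0 ≃ {Θ : LabelledTree (Σ i, β i) // IsComposite (corolla 1) υ Θ} :=
    Equiv.ofBijective
      (fun v => ⟨((υ 0).graft v).relabel e.symm, (isComposite_corolla_one_iff υ _).2
        ⟨v, by rw [relabel_trans, Equiv.symm_trans_self, relabel_refl]⟩⟩)
      ⟨fun v w h => hinj ((relabelEquiv e.symm).injective (congrArg Subtype.val h)), by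
        rintro ⟨Θ, hΘ⟩
        obtain ⟨v, hv⟩ := (isComposite_corolla_one_iff υ _).1 hΘ
        refine ⟨v, Subtype.ext ?_⟩
        simp only [hv]
        rw [relabel_trans, Equiv.self_trans_symm, relabel_refl]⟩
  refine (Fintype.sum_equiv E _ _ fun v => ?_).symm
  refine (treeOn_relabel K e.symm ((υ 0).graft v) _).symm.trans (congrArg (treeOn K _) ?_)
  funext ⟨i, b⟩
  fin_cases i
  · rfl
  · exact congrArg (x 1) (Subsingleton.elim (α := β 1) _ _)

/-- The bracket of a tree with a generator in the free algebra: the generator is attached to an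
arbitrary vertex of the tree. -/
theorem preLieBracket_mu_treeOn {α : Type*} [Fintype α] (T : LabelledTree α) (x : α → V) (y : V) :
    preLieBracket (SRT.mu K V) (treeOn K T x) (SRT.unit K y) =
      ∑ v, treeOn K (T.graft v) fun w => w.elim y x := by
  let β : Fin 2 → Type _ := ![α, PUnit]
  let : ∀ i, Fintype (β i) :=
    Fin.cases ‹Fintype α› fun i => Fin.cases PUnit.fintype (fun i => i.elim0) i
  let : Unique (β 1) := PUnit.instUnique
  let υ : ∀ i, LabelledTree (β i) :=
    Fin.cases T fun i => Fin.cases (star PUnit.unit) (fun i => i.elim0) i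
  let z : ∀ i, β i → V := Fin.cases x fun i => Fin.cases (fun _ => y) (fun i => i.elim0) i
  have h : (![treeOn K T x, SRT.unit K y] : Fin 2 → SRT K V) = fun i => treeOn K (υ i) (z i) := by
    refine funext (Fin.forall_fin_two.2 ⟨rfl, ?_⟩)
    exact (SRT.treeOn_eq_unit K (star PUnit.unit) fun _ => y).symm
  rw [preLieBracket, h, SRT.mu_treeM_treeOn]
  exact compositeSum_corolla_one K υ z

end Composition

/-! ### Increasing trees and the removal of the last leaf. -/

namespace LabelledTree

variable {α β : Type*}

theorem graft_injective :
    Function.Injective fun q : LabelledTree α × α => q.1.graft q.2 := by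
  rintro ⟨S, v⟩ ⟨T, w⟩ h
  have hr := congrArg LabelledTree.root h
  have hp := congrFun (congrArg LabelledTree.parent h)
  have hv : v = w := by simpa using hp none
  have hST : S = T :=
    LabelledTree.ext (by simpa using hr) (funext fun b => by simpa using hp (some b))
  rw [hv, hST]

/-- The hypothesis says that `none` is a leaf and not the root, the root being its own parent. Thus
`none` can be deleted, and the paths of the other vertices never meet it. -/
theorem exists_graft_eq (T : LabelledTree (Option α)) (h : ∀ w, T.parent w ≠ none) :
    ∃ S v, graft S v = T := by
  choose f hf using fun w => Option.ne_none_iff_exists'.1 (h w)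
  obtain ⟨r, hr⟩ : ∃ r, T.root = some r :=
    ⟨f T.root, by rw [← hf, T.parent_root]⟩
  have hit : ∀ (k : ℕ) (b : α), T.parent^[k] (some b) = some ((fun b => f (some b))^[k] b) := by
    intro k
    induction k with
    | zero => intro b; rfl
    | succ k ih => intro b; rw [Function.iterate_succ_apply, hf, ih, Function.iterate_succ_apply]
  refine ⟨⟨r, fun b => f (some b), ?_, fun b => ?_⟩, f none, LabelledTree.ext hr.symm ?_⟩
  · have := T.parent_root
    rw [hr, hf] at this
    exact Option.some_injective _ this
  · obtain ⟨k, hk⟩ := T.reaches_root (some b)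
    refine ⟨k, ?_⟩
    rw [hit, hr] at hk
    exact Option.some_injective _ hk
  · funext w
    rcases w with _ | b
    · exact (hf none).symm
    · exact (hf (some b)).symm

theorem isIncreasing_iff {n : ℕ} (T : LabelledTree (Fin n)) :
    T.IsIncreasing ↔ ∀ v, T.parent v ≤ v := by
  refine ⟨fun h v => h _ _ ⟨1, rfl⟩, ?_⟩
  rintro h v w ⟨k, rfl⟩
  induction k with
  | zero => exact le_rfl
  | succ k ih =>
    rw [Function.iterate_succ_apply']
    exact (h _).trans ih

theorem IsIncreasing.root_eq_zero {n : ℕ} {T : LabelledTree (Fin (n + 1))} (h : T.IsIncreasing) :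
    T.root = 0 :=
  le_antisymm (h _ _ (T.reaches_root 0)) (Fin.zero_le _)

theorem root_of_parent_eq_self (T : LabelledTree α) {v : α} (h : T.parent v = v) : v = T.root := by
  obtain ⟨k, hk⟩ := T.reaches_root v
  rw [← hk, Function.iterate_fixed h]

instance (n : ℕ) : Fintype {T : LabelledTree (Fin n) // T.IsIncreasing} := Fintype.ofFinite _

/-- The labelled tree obtained by attaching a leaf with the greatest label to the vertex `v`. -/
def graftLast {n : ℕ} (T : LabelledTree (Fin n)) (v : Fin n) : LabelledTree (Fin (n + 1)) :=
  (T.graft v).relabel finSuccEquivLast.symm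

theorem graftLast_isIncreasing_iff {n : ℕ} (T : LabelledTree (Fin n)) (v : Fin n) :
    (T.graftLast v).IsIncreasing ↔ T.IsIncreasing := by
  rw [isIncreasing_iff, isIncreasing_iff, Fin.forall_fin_succ']
  simp [graftLast, relabel, Fin.le_last]

/-- Increasing trees are obtained by attaching successively the vertices in the order of the
labels. -/
def increasingGraftEquiv (n : ℕ) :
    (Σ _ : {T : LabelledTree (Fin (n + 1)) // T.IsIncreasing}, Fin (n + 1)) ≃
      {T : LabelledTree (Fin (n + 2)) // T.IsIncreasing} :=
  Equiv.ofBijective (fun q => ⟨q.1.1.graftLast q.2, (graftLast_isIncreasing_iff _ _).2 q.1.2⟩) <| by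
    constructor
    · rintro ⟨⟨S, hS⟩, v⟩ ⟨⟨T, hT⟩, w⟩ h
      have h1 := (relabelEquiv finSuccEquivLast.symm).injective (congrArg Subtype.val h)
      have h2 := graft_injective (a₁ := (S, v)) (a₂ := (T, w)) h1
      simp only [Prod.mk.injEq] at h2
      obtain ⟨rfl, rfl⟩ := h2
      rfl
    · rintro ⟨T, hT⟩
      -- The last label is a leaf: a child of it would have a label at least as large, hence be that
      -- vertex itself, which would then be the root; but the root has label `0`.
      have hne : ∀ w, (T.relabel finSuccEquivLast).parent w ≠ none := by
        intro w hw
        have h1 : T.parent (finSuccEquivLast.symm w) = Fin.last (n + 1) := by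
          rw [← finSuccEquivLast_symm_none, Equiv.eq_symm_apply]
          exact hw
        have h2 := (isIncreasing_iff T).1 hT (finSuccEquivLast.symm w)
        rw [h1, Fin.last_le_iff] at h2
        rw [h2] at h1
        have h3 := T.root_of_parent_eq_self h1
        rw [hT.root_eq_zero] at h3
        exact absurd h3 (Fin.last_pos).ne'
      obtain ⟨S, v, h⟩ := exists_graft_eq _ hne
      have h' : S.graftLast v = T := by
        rw [graftLast, h, relabel_trans, Equiv.self_trans_symm, relabel_refl]
      refine ⟨⟨⟨S, ?_⟩, v⟩, Subtype.ext h'⟩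
      rwa [← graftLast_isIncreasing_iff S v, h']

end LabelledTree

/-! ### Iterated brackets in the free algebra: part (1). -/

section FreeBracket

universe u v

variable (K : Type u) [CommRing K] {V : Type v} [AddCommGroup V] [Module K V]

variable {K} in
/-- The bracket is linear in its first variable. -/
def preLieBracketLeft (γ : SRT K V →ₗ[K] V) (y : V) : V →ₗ[K] V :=
  γ ∘ₗ (treeM K (corolla 1)).toLinearMap ![0, y] 0

variable {K} in
theorem preLieBracketLeft_apply (γ : SRT K V →ₗ[K] V) (y z : V) :
    preLieBracketLeft γ y z = preLieBracket γ z y := by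
  have h : Function.update ![0, y] 0 z = ![z, y] := funext (Fin.forall_fin_two.2 ⟨rfl, rfl⟩)
  rw [preLieBracketLeft, LinearMap.comp_apply, MultilinearMap.toLinearMap_apply, h, preLieBracket]

/-- The element of `S(RT, V)` given by the tree `T` with its root decorated by `x` and its other
vertices by `y`. -/
def rootedEval {n : ℕ} (T : LabelledTree (Fin n)) (x y : V) : SRT K V :=
  treeM K T fun v => if v = T.root then x else y

theorem UnlabelledTree.eval_mk {n : ℕ} (T : LabelledTree (Fin n)) (x y : V) :
    UnlabelledTree.eval K (Quotient.mk (isoSetoid n) T) x y = rootedEval K T x y := rfl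

theorem preLieBracket_mu_rootedEval {n : ℕ} (T : LabelledTree (Fin n)) (x y : V) :
    preLieBracket (SRT.mu K V) (rootedEval K T x y) (SRT.unit K y) =
      ∑ v, rootedEval K (T.graftLast v) x y := by
  rw [rootedEval, ← treeOn_fin, preLieBracket_mu_treeOn]
  refine Finset.sum_congr rfl fun v _ => ?_
  rw [treeOn_eq K finSuccEquivLast.symm]
  refine congrArg (treeM K (T.graftLast v)) (funext fun w => ?_)
  obtain ⟨w, rfl⟩ := finSuccEquivLast.symm.surjective w
  rcases w with _ | b
  · simp [graftLast, relabel, (Fin.castSucc_lt_last T.root).ne']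
  · simp [graftLast, relabel]

theorem iterBracket_mu_eq_sum_increasing (n : ℕ) (x y : V) :
    iterBracket (SRT.mu K V) (SRT.unit K x) (SRT.unit K y) n =
      ∑ T : {T : LabelledTree (Fin (n + 1)) // T.IsIncreasing}, rootedEval K T.1 x y := by
  induction n with
  | zero =>
    have h0 : (corolla 0).IsIncreasing := (isIncreasing_iff _).2 fun v => Fin.zero_le v
    have hu : ∀ T : {T : LabelledTree (Fin (0 + 1)) // T.IsIncreasing}, T = ⟨corolla 0, h0⟩ :=
      fun T => Subtype.ext (LabelledTree.ext (Subsingleton.elim (α := Fin 1) _ _)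
        (funext fun _ => Subsingleton.elim (α := Fin 1) _ _))
    rw [Fintype.sum_eq_single _ fun T hT => absurd (hu T) hT]
    refine congrArg (treeM K (corolla 0)) (funext fun v => ?_)
    rw [if_pos (Subsingleton.elim (α := Fin 1) _ _)]
  | succ n ih =>
    rw [iterBracket, ih, ← (increasingGraftEquiv n).sum_comp, Fintype.sum_sigma]
    rw [← preLieBracketLeft_apply, map_sum]
    simp only [preLieBracketLeft_apply, preLieBracket_mu_rootedEval]
    rfl

theorem iterBracket_mu_eq_sum_lam (n : ℕ) (x y : V) :
    iterBracket (SRT.mu K V) (SRT.unit K x) (SRT.unit K y) n =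
      ∑ t : UnlabelledTree (n + 1), lam t • t.eval K x y := by
  classical
  -- The increasing trees are grouped by isomorphism class; the summand is constant on each class,
  -- whose size is `lam t`.
  rw [iterBracket_mu_eq_sum_increasing, ← Finset.sum_fiberwise_of_maps_to
    (t := Finset.univ) (g := fun T => (Quotient.mk (isoSetoid (n + 1)) T.1 : UnlabelledTree (n + 1)))
    (fun _ _ => Finset.mem_univ _)]
  refine Finset.sum_congr rfl fun t _ => ?_
  have hc : ∀ T ∈ Finset.univ.filter
      (fun T : {T : LabelledTree (Fin (n + 1)) // T.IsIncreasing} =>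
        (Quotient.mk (isoSetoid (n + 1)) T.1 : UnlabelledTree (n + 1)) = t),
      rootedEval K T.1 x y = UnlabelledTree.eval K t x y := by
    intro T hT
    rw [← (Finset.mem_filter.1 hT).2, UnlabelledTree.eval_mk]
  rw [Finset.sum_congr rfl hc, Finset.sum_const, lam]
  congr 1
  rw [← Fintype.card_subtype, ← Nat.card_eq_fintype_card]
  exact Nat.card_congr (Equiv.subtypeSubtypeEquivSubtypeInter _
    fun T : LabelledTree (Fin (n + 1)) => (Quotient.mk (isoSetoid (n + 1)) T) = t)

end FreeBracket

/-! ### Partial Bell polynomials of a derivation, and their vanishing modulo a prime. -/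

section Bell

variable {R A : Type*} [CommRing R] [CommRing A] [Algebra R A] (D : Derivation R A A) (e : A)

/-- The coefficients of `(D + t e)^n (1) = ∑ m, t ^ m * partialBell D e n m`, where `D` is a
derivation and `t` a variable; they are the partial Bell polynomials in the derivatives of `e`. -/
def partialBell : ℕ → ℕ → A
  | 0, 0 => 1
  | 0, _ + 1 => 0
  | n + 1, 0 => D (partialBell n 0)
  | n + 1, m + 1 => D (partialBell n (m + 1)) + e * partialBell n m

theorem partialBell_succ_zero (n : ℕ) : partialBell D e (n + 1) 0 = 0 := by
  induction n with
  | zero => simp [partialBell]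
  | succ n ih => rw [partialBell, ih, map_zero]

theorem partialBell_of_lt {n m : ℕ} (h : n < m) : partialBell D e n m = 0 := by
  induction n generalizing m with
  | zero =>
    obtain ⟨m, rfl⟩ := Nat.exists_eq_succ_of_ne_zero h.ne'
    rfl
  | succ n ih =>
    obtain ⟨m, rfl⟩ := Nat.exists_eq_succ_of_ne_zero (Nat.ne_zero_of_lt h)
    rw [partialBell, ih (by omega), ih (by omega), map_zero, mul_zero, add_zero]

theorem partialBell_self (n : ℕ) : partialBell D e n n = e ^ n := by
  induction n with
  | zero => simp [partialBell]
  | succ n ih => rw [partialBell, partialBell_of_lt D e (Nat.lt_succ_self n), ih, map_zero, zero_add,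
      pow_succ']

theorem partialBell_one (n : ℕ) : partialBell D e (n + 1) 1 = D^[n] e := by
  induction n with
  | zero => simp [partialBell]
  | succ n ih =>
    rw [partialBell, ih, partialBell_succ_zero, mul_zero, add_zero, Function.iterate_succ_apply']

/-- The case `t = 1` of the generating function: the sum over `m` is `(D + e)^n (1)`. -/
theorem sum_partialBell_succ (n : ℕ) :
    ∑ m ∈ Finset.range (n + 2), partialBell D e (n + 1) m =
      D (∑ m ∈ Finset.range (n + 1), partialBell D e n m) +
        e * ∑ m ∈ Finset.range (n + 1), partialBell D e n m := by
  have h : D (∑ m ∈ Finset.range (n + 1), partialBell D e n m) =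
      D (∑ m ∈ Finset.range (n + 2), partialBell D e n m) := by
    rw [Finset.sum_range_succ _ (n + 1), partialBell_of_lt D e (Nat.lt_succ_self n), add_zero]
  rw [h, Finset.sum_range_succ', Finset.sum_range_succ' _ (n + 1), map_add, map_sum,
    Finset.mul_sum]
  simp only [partialBell, Finset.sum_add_distrib]
  ring

/-- `partialBell D e n m` counts partitions of an `n`-set into `m` blocks, a block of size `k + 1`
having weight `D^[k] e`. Both sides count partitions into `m + 1` blocks with one block
distinguished, of size `k + 1` on the right. The factor `m + 1` is not divided out, so the identity
holds in every characteristic. The proof is by induction on `n`, applying `D` to the identity and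
using Pascal's rule. -/
theorem succ_mul_partialBell (n m : ℕ) :
    (m + 1 : A) * partialBell D e n (m + 1) =
      ∑ k ∈ Finset.range n, (n.choose (k + 1) : A) * (D^[k] e * partialBell D e (n - 1 - k) m) := by
  induction n generalizing m with
  | zero => simp [partialBell]
  | succ n ih =>
    -- Unfold `partialBell D e (n - k) m` by its recursion; the terms containing the factor `e` are
    -- summed by the induction hypothesis for `m - 1`.
    have key : ∀ m, ∑ k ∈ Finset.range n,
        (n.choose (k + 1) : A) * (D^[k] e * D (partialBell D e (n - 1 - k) m)) +
          (m : A) * (e * partialBell D e n m) =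
        ∑ k ∈ Finset.range n, (n.choose (k + 1) : A) * (D^[k] e * partialBell D e (n - k) m) := by
      intro m
      rcases m with _ | m
      · rw [Nat.cast_zero, zero_mul, add_zero]
        refine Finset.sum_congr rfl fun k hk => ?_
        rw [Finset.mem_range] at hk
        rw [show n - k = (n - 1 - k) + 1 by omega, partialBell]
      · rw [Nat.cast_succ, mul_left_comm, ih m, Finset.mul_sum, ← Finset.sum_add_distrib]
        refine Finset.sum_congr rfl fun k hk => ?_
        rw [Finset.mem_range] at hk
        rw [show n - k = (n - 1 - k) + 1 by omega, partialBell]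
        ring
    have hD : D ((m + 1 : A) * partialBell D e n (m + 1)) =
        (m + 1 : A) * D (partialBell D e n (m + 1)) := by
      rw [← Nat.cast_succ, ← nsmul_eq_mul, ← nsmul_eq_mul, map_nsmul]
    have hS : D (∑ k ∈ Finset.range n,
          (n.choose (k + 1) : A) * (D^[k] e * partialBell D e (n - 1 - k) m)) =
        ∑ k ∈ Finset.range n,
          (n.choose (k + 1) : A) * (D^[k + 1] e * partialBell D e (n - 1 - k) m) +
        ∑ k ∈ Finset.range n,
          (n.choose (k + 1) : A) * (D^[k] e * D (partialBell D e (n - 1 - k) m)) := by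
      rw [map_sum, ← Finset.sum_add_distrib]
      refine Finset.sum_congr rfl fun k _ => ?_
      rw [← nsmul_eq_mul, map_nsmul, Derivation.leibniz, Function.iterate_succ_apply']
      simp only [nsmul_eq_mul, smul_eq_mul]
      ring
    have hT : ∑ k ∈ Finset.range (n + 1),
          ((n + 1).choose (k + 1) : A) * (D^[k] e * partialBell D e (n + 1 - 1 - k) m) =
        ∑ k ∈ Finset.range (n + 1), (n.choose k : A) * (D^[k] e * partialBell D e (n - k) m) +
        ∑ k ∈ Finset.range (n + 1),
          (n.choose (k + 1) : A) * (D^[k] e * partialBell D e (n - k) m) := by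
      rw [← Finset.sum_add_distrib]
      refine Finset.sum_congr rfl fun k _ => ?_
      rw [Nat.choose_succ_succ, Nat.add_sub_cancel]
      push_cast
      ring
    rw [hT, Finset.sum_range_succ', Finset.sum_range_succ _ n, ← key m, Nat.choose_succ_self,
      partialBell, mul_add, ← hD, ih, hS]
    have hN : ∀ k, n - 1 - k = n - (k + 1) := fun k => by omega
    simp only [hN, Nat.choose_zero_right, Nat.cast_one, Nat.cast_zero, Function.iterate_zero, id,
      Nat.sub_zero]
    ring

/-- In `succ_mul_partialBell` for `n = p` the binomial coefficients vanish modulo `p`, except for a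
distinguished block of size `p`, which leaves no elements for the remaining `m - 1 ≥ 1` blocks. The
factor `m < p` is invertible. -/
theorem partialBell_eq_zero {p : ℕ} (hp : p.Prime) [CharP A p] {m : ℕ} (h1 : 1 < m) (h2 : m < p) :
    partialBell D e p m = 0 := by
  obtain ⟨m, rfl⟩ : ∃ l, m = l + 2 := ⟨m - 2, by omega⟩
  have h := succ_mul_partialBell D e p (m + 1)
  rw [Finset.sum_eq_zero] at h
  · have hu : IsUnit (((m + 1 : ℕ) : A) + 1) := by
      rw [← Nat.cast_succ, CharP.isUnit_natCast_iff hp]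
      exact Nat.not_dvd_of_pos_of_lt (Nat.succ_pos _) h2
    exact hu.mul_right_eq_zero.1 h
  · intro k hk
    rw [Finset.mem_range] at hk
    rcases Nat.lt_or_ge (k + 1) p with hkp | hkp
    · rw [(CharP.cast_eq_zero_iff A p _).2 (hp.dvd_choose_self (Nat.succ_ne_zero k) hkp), zero_mul]
    · rw [show p - 1 - k = 0 by omega, partialBell, mul_zero, mul_zero]

theorem sum_partialBell_prime {p : ℕ} (hp : p.Prime) [CharP A p] :
    ∑ m ∈ Finset.range (p + 1), partialBell D e p m = e ^ p + D^[p - 1] e := by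
  obtain ⟨q, rfl⟩ : ∃ q, p = q + 1 := ⟨p - 1, by have := hp.pos; omega⟩
  have hq : 1 < q + 1 := hp.one_lt
  rw [Finset.sum_range_succ, partialBell_self, add_comm, Nat.add_sub_cancel, ← partialBell_one,
    Finset.sum_eq_single_of_mem 1 (Finset.mem_range.2 hq)]
  intro m hm h1
  rw [Finset.mem_range] at hm
  rcases Nat.eq_zero_or_pos m with rfl | h0
  · exact partialBell_succ_zero D e q
  · exact partialBell_eq_zero D e hp (by omega) hm

end Bell

/-! ### Attaching a vertex to a leaf of a corolla, as an operadic substitution. -/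

section StarComposition

variable {α : Type*}

/-- The vertices of the tree substituted for `i` when a tree with two vertices is substituted
for `j` and trees with one vertex for the other vertices. -/
abbrev GraftFiber (j i : α) : Type _ := {w : Option α // w.getD j = i}

/-- The root of the tree substituted for `i`. -/
def GraftFiber.base (j i : α) : GraftFiber j i := ⟨some i, rfl⟩

/-- Every edge of the corolla ends at `r`, and as `j ≠ r` the tree substituted for `r` has only one
vertex. No choice is left, so there is exactly one composite. -/
theorem isComposite_star_iff {r j : α} (hj : j ≠ r) (Θ : LabelledTree (Σ i, GraftFiber j i)) :
    IsComposite (star r) (fun i => star (GraftFiber.base j i)) Θ ↔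
      Θ = ((star r).graft j).relabel (Equiv.sigmaFiberEquiv fun w : Option α => w.getD j).symm := by
  set e := Equiv.sigmaFiberEquiv fun w : Option α => w.getD j
  constructor
  · intro h
    refine LabelledTree.ext h.root_eq (funext fun q => ?_)
    obtain ⟨w, rfl⟩ := e.symm.surjective q
    change _ = e.symm (((star r).graft j).parent (e (e.symm w)))
    rw [Equiv.apply_symm_apply]
    rcases w with _ | i
    · exact h.parent_inner j ⟨none, rfl⟩ fun h' => Option.some_ne_none j (congrArg Subtype.val h').symm
    · change _ = e.symm (some r)
      by_cases hi : i = r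
      · subst hi
        have hroot : e.symm (some i) = Θ.root := h.root_eq.symm
        rw [hroot, Θ.parent_root]
      · have h1 := h.parent_outer i hi
        change (Θ.parent (e.symm (some i))).1 = r at h1
        revert h1
        generalize Θ.parent (e.symm (some i)) = q
        obtain ⟨w, rfl⟩ := e.symm.surjective q
        rcases w with _ | k
        · intro h1
          exact absurd h1 hj
        · rintro (rfl : k = r)
          rfl
  · rintro rfl
    have hp : ∀ w, (((star r).graft j).relabel e.symm).parent (e.symm w) =
        e.symm (((star r).graft j).parent w) := fun w => by simp [relabel]
    refine ⟨rfl, ?_, ?_⟩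
    · rintro i ⟨w, rfl⟩ hb
      rcases w with _ | i
      · exact hp none
      · exact absurd rfl hb
    · intro i _
      exact congrArg Sigma.fst (hp (some i))

universe u v

variable (K : Type u) [CommRing K] {V : Type v} [AddCommGroup V] [Module K V]

theorem compositeSum_star [Fintype α] [∀ j i : α, Fintype (GraftFiber j i)] {r j : α} (hj : j ≠ r)
    (x : Option α → V) :
    compositeSum K (star r) (fun i => star (GraftFiber.base j i)) (fun _ b => x b.1) =
      treeOn K ((star r).graft j) x := by
  rw [compositeSum, Fintype.sum_eq_single ⟨_, (isComposite_star_iff hj _).2 rfl⟩]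
  · exact treeOn_relabel K (Equiv.sigmaFiberEquiv fun w : Option α => w.getD j).symm _ x
  · rintro ⟨Θ, hΘ⟩ hne
    exact absurd (Subtype.ext ((isComposite_star_iff hj Θ).1 hΘ)) hne

end StarComposition

/-! ### The bracket acting on corollas in a `PreLie`-algebra. -/

namespace PreLieAlgebra

universe u v

variable {K : Type u} [CommRing K] {V : Type v} [AddCommGroup V] [Module K V]
  (A : PreLieAlgebra K V)

theorem γ_unit_apply (x : V) : A.γ (SRT.unit K x) = x := LinearMap.congr_fun A.γ_unit x

theorem γ_mu_treeOn {α : Type*} [Fintype α] (T : LabelledTree α) (s : α → SRT K V) :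
    A.γ (SRT.mu K V (treeOn K T s)) = A.γ (treeOn K T fun i => A.γ (s i)) := by
  have h := LinearMap.congr_fun A.γ_mu (treeOn K T s)
  rwa [LinearMap.comp_apply, LinearMap.comp_apply, SRT.map_treeOn] at h

theorem γ_preLieBracket_mu (s t : SRT K V) :
    A.γ (preLieBracket (SRT.mu K V) s t) = preLieBracket A.γ (A.γ s) (A.γ t) := by
  have h : (fun i => A.γ ((![s, t] : Fin 2 → SRT K V) i)) = ![A.γ s, A.γ t] :=
    funext (Fin.forall_fin_two.2 ⟨rfl, rfl⟩)
  rw [preLieBracket, ← treeOn_fin, γ_mu_treeOn, h, treeOn_fin, preLieBracket]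

/-- The fibre over `j` is the tree `F_1(x j, y)`, whose value is a bracket; the other fibres are
single vertices, on which the unit law applies. -/
theorem γ_treeOn_graftFiber {α : Type*} [DecidableEq α] (j i : α) [Fintype (GraftFiber j i)]
    (x : α → V) (y : V) :
    A.γ (treeOn K (star (GraftFiber.base j i)) fun b => b.1.elim y x) =
      Function.update x j (preLieBracket A.γ (x j) y) i := by
  by_cases hi : i = j
  · subst hi
    let e : GraftFiber i i ≃ Fin 2 :=
      { toFun := fun b => b.1.elim 1 fun _ => 0
        invFun := ![GraftFiber.base i i, ⟨none, rfl⟩]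
        left_inv := by
          rintro ⟨w, hw⟩
          rcases w with _ | k
          · rfl
          · obtain rfl : k = i := hw
            rfl
        right_inv := Fin.forall_fin_two.2 ⟨rfl, rfl⟩ }
    rw [treeOn_eq K e, Function.update_self, preLieBracket]
    refine congrArg (fun z => A.γ (treeM K (corolla 1) z)) ?_
    exact funext (Fin.forall_fin_two.2 ⟨rfl, rfl⟩)
  · let : Unique (GraftFiber j i) :=
      { default := GraftFiber.base j i
        uniq := by
          rintro ⟨w, hw⟩
          rcases w with _ | k
          · exact absurd hw.symm hi
          · obtain rfl : k = i := hw
            rfl }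
    rw [SRT.treeOn_eq_unit, γ_unit_apply, Function.update_of_ne hi]
    rfl

theorem γ_treeOn_graft_star {α : Type*} [Fintype α] [DecidableEq α] {r j : α} (hj : j ≠ r)
    (x : α → V) (y : V) :
    A.γ (treeOn K ((star r).graft j) fun w => w.elim y x) =
      A.γ (treeOn K (star r) (Function.update x j (preLieBracket A.γ (x j) y))) := by
  rw [← compositeSum_star K hj, ← SRT.mu_treeOn, γ_mu_treeOn]
  simp only [γ_treeOn_graftFiber]

/-- The bracket with `y` acts on a corolla by attaching a new leaf to the root and by derivation
on the decorations of the leaves. -/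
theorem preLieBracket_γ_star {ι : Type*} [Fintype ι] [DecidableEq ι] (x y : V) (b : ι → V) :
    preLieBracket A.γ (A.γ (treeOn K (LabelledTree.star none) fun w : Option ι => w.elim x b)) y =
      A.γ (treeOn K (LabelledTree.star none) fun w : Option (Option ι) => w.elim x fun w => w.elim y b) +
      ∑ j, A.γ (treeOn K (LabelledTree.star none) fun w : Option ι =>
        w.elim x (Function.update b j (preLieBracket A.γ (b j) y))) := by
  have h := A.γ_preLieBracket_mu (treeOn K (LabelledTree.star none) fun w : Option ι => w.elim x b)
    (SRT.unit K y)
  rw [γ_unit_apply, preLieBracket_mu_treeOn, map_sum, Fintype.sum_option] at h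
  rw [← h]
  refine congrArg₂ _ ?_ (Finset.sum_congr rfl fun j _ => ?_)
  · let e : Option (Option ι) ≃ Option (Option ι) :=
      Equiv.swap none (some none)
    rw [star_graft, ← treeOn_relabel K e, star_relabel]
    have he : e (some none) = none := Equiv.swap_apply_right _ _
    rw [he]
    refine congrArg (fun z => A.γ (treeOn K _ z)) (funext fun w => ?_)
    rcases w with _ | _ | i
    · simp [e]
    · simp [e]
    · have : e.symm (some (some i)) = some (some i) :=
        Equiv.swap_apply_of_ne_of_ne (by simp) (by simp)
      simp [this]
  · rw [γ_treeOn_graft_star A (Option.some_ne_none j)]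
    refine congrArg (fun z => A.γ (treeOn K _ z)) (funext fun w => ?_)
    rcases w with _ | i
    · rw [Function.update_of_ne (Option.some_ne_none j).symm]
      rfl
    · by_cases hi : i = j
      · subst hi; simp
      · simp [hi]

end PreLieAlgebra

/-! ### Products, multisets and monomials. -/

theorem Derivation.leibniz_prod_update {R A ι : Type*} [CommRing R] [CommRing A] [Algebra R A]
    [DecidableEq ι] (D : Derivation R A A) (s : Finset ι) (f : ι → A) :
    D (∏ i ∈ s, f i) = ∑ j ∈ s, ∏ i ∈ s, Function.update f j (D (f j)) i := by
  induction s using Finset.induction_on with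
  | empty => simp
  | insert a s ha ih =>
    have h1 : ∏ i ∈ s, Function.update f a (D (f a)) i = ∏ i ∈ s, f i :=
      Finset.prod_congr rfl fun i hi => Function.update_of_ne (ne_of_mem_of_not_mem hi ha) _ _
    have h2 : ∀ j ∈ s, ∏ i ∈ insert a s, Function.update f j (D (f j)) i =
        f a * ∏ i ∈ s, Function.update f j (D (f j)) i := fun j hj => by
      rw [Finset.prod_insert ha, Function.update_of_ne (ne_of_mem_of_not_mem hj ha).symm]
    rw [Finset.prod_insert ha, D.leibniz, ih, Finset.sum_insert ha, Finset.sum_congr rfl h2,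
      Finset.prod_insert ha, h1, Function.update_self, smul_eq_mul, smul_eq_mul, Finset.mul_sum]
    ring

/-- Equal multiplicities give fibres of equal size, and bijections of the fibres glue. -/
theorem exists_equiv_of_map_univ_eq {ι κ γ : Type*} [Fintype ι] [Fintype κ] {f : ι → γ} {g : κ → γ}
    (h : Finset.univ.val.map f = Finset.univ.val.map g) : ∃ e : ι ≃ κ, g ∘ e = f := by
  classical
  have hc : ∀ c, Nonempty ({i // f i = c} ≃ {k // g k = c}) := fun c => by
    refine Fintype.card_eq.1 ?_
    have := congrArg (Multiset.count c) h
    rw [Multiset.count_map, Multiset.count_map] at this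
    rw [Fintype.card_subtype, Fintype.card_subtype]
    simpa only [eq_comm, Finset.card_def, Finset.filter_val] using this
  exact ⟨Equiv.ofFiberEquiv fun c => (hc c).some, funext fun i => Equiv.ofFiberEquiv_map _ i⟩

theorem MvPolynomial.prod_X_eq_monomial {R σ ι : Type*} [CommSemiring R] [DecidableEq σ]
    [Fintype ι] (l : ι → σ) :
    ∏ i, (X (l i) : MvPolynomial σ R) =
      monomial (Multiset.toFinsupp (Finset.univ.val.map l)) 1 := by
  have h : Multiset.toFinsupp (Finset.univ.val.map l) = ∑ i, Finsupp.single (l i) 1 := by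
    rw [Multiset.toFinsupp_eq_iff, Finsupp.toMultiset_sum]
    simp only [Finsupp.toMultiset_single, one_smul]
    rw [← Multiset.sum_map_singleton (Finset.univ.val.map l), Multiset.map_map]
    rfl
  rw [h, MvPolynomial.monomial_sum_one]
  rfl

theorem MvPolynomial.basisMonomials_apply {R σ : Type*} [CommSemiring R] (s : σ →₀ ℕ) :
    MvPolynomial.basisMonomials σ R s = MvPolynomial.monomial s 1 := rfl

/-! ### Corollas encoded by polynomials: part (2). -/

namespace PreLieAlgebra

universe u v

variable {K : Type u} [CommRing K] {V : Type v} [AddCommGroup V] [Module K V]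
  (A : PreLieAlgebra K V)

/-- The value of the corolla with its root decorated by `x` and its leaves by the `b i`. -/
def corollaValue {ι : Type*} [Fintype ι] (x : V) (b : ι → V) : V :=
  A.γ (treeOn K (LabelledTree.star none) fun w : Option ι => w.elim x b)

theorem corollaValue_comp_equiv {ι κ : Type*} [Fintype ι] [Fintype κ] (e : ι ≃ κ) (x : V)
    (b : κ → V) : A.corollaValue x (b ∘ e) = A.corollaValue x b := by
  rw [corollaValue, corollaValue, ← treeOn_relabel K e.optionCongr, star_relabel]
  refine congrArg (fun z => A.γ (treeOn K _ z)) (funext fun w => ?_)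
  obtain ⟨w, rfl⟩ := e.optionCongr.surjective w
  rw [Function.comp_apply, Equiv.symm_apply_apply]
  rcases w with _ | i <;> rfl

theorem corollaValue_fin (n : ℕ) (x : V) (b : Fin n → V) :
    A.corollaValue x b = A.γ (treeM K (corolla n) (Fin.cons x b)) := by
  rw [corollaValue, treeOn_eq K (finSuccEquiv n).symm, star_relabel, corolla_eq_star,
    finSuccEquiv_symm_none]
  refine congrArg (fun z => A.γ (treeM K _ z)) (funext fun w => ?_)
  refine Fin.cases ?_ (fun i => ?_) w <;> simp

/-- The linear map which sends the monomial `X_{k_1} ⋯ X_{k_m}` to the value of the corolla with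
its root decorated by `x` and its leaves by `w k_1, …, w k_m`. -/
def corollaMap (x : V) (w : ℕ → V) : MvPolynomial ℕ K →ₗ[K] V :=
  (MvPolynomial.basisMonomials ℕ K).constr K fun s =>
    A.corollaValue x fun i : (Finsupp.toMultiset s).ToType => w i.1

/-- A monomial remembers only the multiset of its indices, which suffices because permuting the
leaves of a corolla does not change its value. -/
theorem corollaMap_prod_X {ι : Type*} [Fintype ι] (x : V) (w : ℕ → V) (l : ι → ℕ) :
    A.corollaMap x w (∏ i, MvPolynomial.X (l i)) = A.corollaValue x (w ∘ l) := by
  rw [MvPolynomial.prod_X_eq_monomial, corollaMap, ← MvPolynomial.basisMonomials_apply,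
    Module.Basis.constr_basis, Multiset.toFinsupp_toMultiset]
  obtain ⟨e, he⟩ := exists_equiv_of_map_univ_eq (Multiset.map_univ_coe (Finset.univ.val.map l))
  rw [← corollaValue_comp_equiv A e x (w ∘ l), Function.comp_assoc, he]
  rfl

/-- The derivation of the polynomial ring which sends `X_k` to `X_{k + 1}`. -/
def shiftDerivation (K : Type*) [CommRing K] :
    Derivation K (MvPolynomial ℕ K) (MvPolynomial ℕ K) :=
  MvPolynomial.mkDerivation K fun k => MvPolynomial.X (k + 1)

theorem shiftDerivation_X (k : ℕ) :
    shiftDerivation K (MvPolynomial.X k) = MvPolynomial.X (k + 1) :=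
  MvPolynomial.mkDerivation_X _ _ _

/-- On monomials this is `preLieBracket_γ_star`: multiplication by `X 0` adds a leaf decorated by `w
0 = y`, and the derivation matches `{w k, y} = w (k + 1)` on one leaf at a time. -/
theorem corollaMap_shift_add_mul (x y : V) (f : MvPolynomial ℕ K) :
    A.corollaMap x (iterBracket A.γ y y) (shiftDerivation K f + MvPolynomial.X 0 * f) =
      preLieBracket A.γ (A.corollaMap x (iterBracket A.γ y y) f) y := by
  classical
  set w := iterBracket A.γ y y with hw
  suffices h : A.corollaMap x w ∘ₗ ((shiftDerivation K : _ →ₗ[K] _) +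
      LinearMap.mulLeft K (MvPolynomial.X 0)) = preLieBracketLeft A.γ y ∘ₗ A.corollaMap x w by
    have := LinearMap.congr_fun h f
    rw [LinearMap.comp_apply, LinearMap.comp_apply, preLieBracketLeft_apply] at this
    exact this
  refine (MvPolynomial.basisMonomials ℕ K).ext fun s => ?_
  obtain ⟨ι, _, l, hl⟩ : ∃ (ι : Type) (_ : Fintype ι) (l : ι → ℕ),
      MvPolynomial.basisMonomials ℕ K s = ∏ i, MvPolynomial.X (l i) := by
    refine ⟨(Finsupp.toMultiset s).ToType, inferInstance, fun i => i.1, ?_⟩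
    rw [MvPolynomial.prod_X_eq_monomial, Multiset.map_univ_coe, Finsupp.toMultiset_toFinsupp,
      MvPolynomial.coe_basisMonomials]
  have hD : shiftDerivation K (∏ i, MvPolynomial.X (l i)) =
      ∑ j, ∏ i, MvPolynomial.X (Function.update l j (l j + 1) i) := by
    rw [Derivation.leibniz_prod_update]
    refine Finset.sum_congr rfl fun j _ => Finset.prod_congr rfl fun i _ => ?_
    rw [shiftDerivation_X]
    exact (Function.apply_update (fun _ k => (MvPolynomial.X k : MvPolynomial ℕ K)) l j _ i).symm
  have hX : (MvPolynomial.X 0 * ∏ i, MvPolynomial.X (l i) : MvPolynomial ℕ K) =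
      ∏ i : Option ι, MvPolynomial.X (i.elim 0 l) := by
    rw [Fintype.prod_option]
    rfl
  rw [hl, LinearMap.comp_apply, LinearMap.comp_apply, preLieBracketLeft_apply, LinearMap.add_apply,
    LinearMap.mulLeft_apply, Derivation.coeFn_coe, hD, hX, map_add, map_sum]
  simp only [corollaMap_prod_X]
  rw [corollaValue.eq_1 A x (w ∘ l), preLieBracket_γ_star, add_comm]
  refine congrArg₂ _ ?_ (Finset.sum_congr rfl fun j _ => ?_)
  · refine congrArg (fun z => A.γ (treeOn K _ z)) (funext fun i => ?_)
    rcases i with _ | _ | i <;> rfl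
  · rw [corollaValue]
    refine congrArg (fun z => A.γ (treeOn K _ z)) (funext fun i => ?_)
    rcases i with _ | i
    · rfl
    · exact Function.apply_update (fun _ => w) l j _ i

theorem corollaMap_sum_partialBell (x y : V) (n : ℕ) :
    A.corollaMap x (iterBracket A.γ y y) (∑ m ∈ Finset.range (n + 1),
      partialBell (shiftDerivation K) (MvPolynomial.X 0) n m) =
      iterBracket A.γ x y n := by
  induction n with
  | zero =>
    -- The polynomial `1` encodes the corolla without leaves, whose value is `x`.
    have h := A.corollaMap_prod_X x (iterBracket A.γ y y) (Fin.elim0 : Fin 0 → ℕ)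
    rw [Finset.univ_eq_empty, Finset.prod_empty] at h
    rw [zero_add, Finset.sum_range_one, partialBell, h, corollaValue, SRT.treeOn_eq_unit,
      γ_unit_apply]
    rfl
  | succ n ih =>
    rw [sum_partialBell_succ, iterBracket, ← ih, ← corollaMap_shift_add_mul]

theorem iterate_shiftDerivation (n : ℕ) :
    (shiftDerivation K)^[n] (MvPolynomial.X 0) = MvPolynomial.X n := by
  induction n with
  | zero => rfl
  | succ n ih =>
    rw [Function.iterate_succ_apply', ih]
    exact shiftDerivation_X n

/-- The two surviving terms `X_0^p` and `X_{p-1}` of the Bell polynomial are read back as corollas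
with `p` leaves and with one leaf. -/
theorem iterBracket_prime {p : ℕ} (hp : p.Prime) [CharP K p] (x y : V) :
    iterBracket A.γ x y p = A.γ (treeM K (corolla p) (Fin.cons x fun _ => y)) +
      preLieBracket A.γ x (iterBracket A.γ y y (p - 1)) := by
  rw [← corollaMap_sum_partialBell, sum_partialBell_prime _ _ hp, iterate_shiftDerivation, map_add]
  have h1 := A.corollaMap_prod_X x (iterBracket A.γ y y) fun _ : Fin p => 0
  rw [Finset.prod_const, Finset.card_univ, Fintype.card_fin, corollaValue_fin] at h1
  have h2 := A.corollaMap_prod_X x (iterBracket A.γ y y) fun _ : Fin 1 => p - 1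
  rw [Finset.prod_const, Finset.card_univ, Fintype.card_fin, pow_one, corollaValue_fin] at h2
  rw [h1, h2, preLieBracket]
  refine congrArg₂ _ rfl (congrArg (fun z => A.γ (treeM K (corolla 1) z)) ?_)
  exact funext (Fin.forall_fin_two.2 ⟨rfl, rfl⟩)

end PreLieAlgebra

end

theorem lemma4 {K : Type*} [CommRing K] {V : Type*} [AddCommGroup V] [Module K V] :
    (∀ (n : ℕ) (x y : V),
      iterBracket (SRT.mu K V) (SRT.unit K x) (SRT.unit K y) n =
        ∑ t : UnlabelledTree (n + 1), lam t • t.eval K x y) ∧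
    (∀ (p : ℕ), p.Prime → CharP K p → ∀ (A : PreLieAlgebra K V) (x y : V),
      iterBracket A.γ x y p = preLieBracket A.γ x (iterBracket A.γ y y (p - 1)) ↔
        A.γ (treeM K (LabelledTree.corolla p) (Fin.cons x fun _ => y)) = 0) := by
  refine ⟨iterBracket_mu_eq_sum_lam K, fun p hp _ A x y => ?_⟩
  rw [A.iterBracket_prime hp, add_eq_right]
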